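/- Let $L\ge 1$ be a fixed integer. For $N\ge 1$ consider the random polynomial $$\psi_N(z)=\sum_{m=0}^{N}\sqrt{\binom{m+L-1}{m}}\;a_m z^m ,$$ where $a_0,\dots,a_N$ are independent standard complex Gaussian random variables ($Ea_m=0$, $E|a_m|^2=1$, $Ea_m^2=0$). Let $z_1,\dots,z_N$ be its zeros, counted with multiplicity, and for real $x$ let $$P_N(x)=\frac1N\,E\,\#\{j:\ |z_j|^2\le x\}$$ be the expected fraction of zeros in the disk $|z|^2\le x$ (the counting variable is integrable). Let $g(s)=(e^s-1)/s$, $g(0)=1$, which is a smooth function on $\mathbb R$, and let $g^{(j)}$ be its $j$-th derivative; then $g^{(L-1)}(s)>0$ for all $s\in\mathbb R$. Put $$P(s)=\frac{g^{(L)}(s)}{g^{(L-1)}(s)} .$$ Then the following hold. 1. For every $s\in\mathbb R$, $\lim_{N\to\infty}P_N\left(1+\frac sN\right)=P(s)$. Moreover, for every $A>0$ there is a constant $C$, depending only on $L$ and $A$, such that $$\left|P_N\left(1+\frac sN\right)-P(s)\right|\le \frac CN\qquad\text{for all } N\ge1,\ s\in[-A,A].$$ 2. In particular, $P_N(1)=\dfrac{L}{L+1}+O(N^{-1})$: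 there is a constant $C$, depending only on $L$, such that $\left|P_N(1)-\frac{L}{L+1}\right|\le\frac CN$ for all $N\ge1$. 3. As $s\to-\infty$, $\ P(s)=-\dfrac Ls+O\left((-s)^{L-1}e^{s}\right)$. 4. As $s\to+\infty$, $\ P(s)=1-\dfrac1s+\dfrac{L-1}{s^2}+O\left(s^{-3}\right)$. -/

import Mathlib

open MeasureTheory ProbabilityTheory Filter Topology Asymptotics
open scoped NNReal

universe u

namespace SU11

noncomputable section

/-- The standard complex Gaussian law: independent real and imaginary parts, each a centred real
Gaussian of variance `1/2`, so that `E a = 0`, `E |a|^2 = 1`, `E a^2 = 0`. -/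
def stdComplexGaussian : Measure ℂ :=
  ((gaussianReal 0 (1 / 2 : ℝ≥0)).prod (gaussianReal 0 (1 / 2 : ℝ≥0))).map
    Complex.measurableEquivRealProd.symm

/-- `a` is a family of independent standard complex Gaussian random variables. -/
structure IsStdComplexGaussianFamily {ι Ω : Type*} [MeasurableSpace Ω] (μ : Measure Ω)
    (a : ι → Ω → ℂ) : Prop where
  hasLaw : ∀ m, HasLaw (a m) stdComplexGaussian μ
  indep : iIndepFun a μ

/-- The polynomial `∑_{m=0}^N √(C(m+L-1, m)) c_m z^m` with coefficient vector `c`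
(used for `L ≥ 1`). -/
def poly (L N : ℕ) (c : Fin (N + 1) → ℂ) : Polynomial ℂ :=
  ∑ m : Fin (N + 1),
    Polynomial.monomial (m : ℕ) (((√((m + L - 1).choose m : ℝ) : ℝ) : ℂ) * c m)

/-- The number of zeros `z` of `p`, counted with multiplicity, such that `|z|^2 ≤ x`. -/
def zeroCount (p : Polynomial ℂ) (x : ℝ) : ℕ :=
  (p.roots.filter (fun z : ℂ => ‖z‖ ^ 2 ≤ x)).card

/-- The expected fraction `N⁻¹ E #{j : |z_j|^2 ≤ x}` of zeros in the disk `|z|^2 ≤ x` of the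
random polynomial of degree `N` with the random coefficients `a`. -/
def expectedFraction {Ω : Type*} [MeasurableSpace Ω] (μ : Measure Ω) (L : ℕ) {N : ℕ}
    (a : Fin (N + 1) → Ω → ℂ) (x : ℝ) : ℝ :=
  (N : ℝ)⁻¹ * ∫ ω, (zeroCount (poly L N (fun m => a m ω)) x : ℝ) ∂μ

/-- `g(s) = (e^s - 1)/s = ∑_j s^j/(j+1)!`, with the removable singularity at `0` filled in. -/
def g (s : ℝ) : ℝ := if s = 0 then 1 else (Real.exp s - 1) / s

/-- `P(s) = g^{(L)}(s) / g^{(L-1)}(s)` (used for `L ≥ 1`). -/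
def limitFraction (L : ℕ) (s : ℝ) : ℝ := iteratedDeriv L g s / iteratedDeriv (L - 1) g s

end

end SU11

namespace SU11

lemma zeroCount_zero (x : ℝ) : zeroCount 0 x = 0 := by simp [zeroCount]

lemma zeroCount_sq (p : Polynomial ℂ) {r : ℝ} (hr : 0 ≤ r) :
    zeroCount p (r ^ 2) = (p.roots.filter (fun z : ℂ => ‖z‖ ≤ r)).card := by
  unfold zeroCount
  congr 1
  refine Multiset.filter_congr fun z _ => ?_
  exact sq_le_sq₀ (norm_nonneg z) hr

lemma zeroCount_of_neg (p : Polynomial ℂ) {x : ℝ} (hx : x < 0) : zeroCount p x = 0 := by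
  unfold zeroCount
  rw [Multiset.card_eq_zero, Multiset.filter_eq_nil]
  intro z _ h
  exact absurd (h.trans_lt hx) (not_lt.2 (by positivity))

lemma zeroCount_le_natDegree (p : Polynomial ℂ) (x : ℝ) : zeroCount p x ≤ p.natDegree :=
  (Multiset.card_le_card (Multiset.filter_le _ _)).trans p.card_roots'

lemma mahlerMeasure_comp_C_mul_X {p : Polynomial ℂ} {R : ℝ} (hR : 0 < R) :
    (p.comp (Polynomial.C (R : ℂ) * Polynomial.X)).mahlerMeasure =
      ‖p.leadingCoeff‖ * (p.roots.map (fun a => max R ‖a‖)).prod := by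
  have hp : p = Polynomial.C p.leadingCoeff *
      (p.roots.map (fun a => Polynomial.X - Polynomial.C a)).prod :=
    (IsAlgClosed.splits p).eq_prod_roots
  conv_lhs => rw [hp]
  rw [Polynomial.mul_comp, Polynomial.C_comp, Polynomial.mahlerMeasure_mul,
    Polynomial.mahlerMeasure_const, Polynomial.multiset_prod_comp,
    Polynomial.prod_mahlerMeasure_eq_mahlerMeasure_prod, Multiset.map_map, Multiset.map_map]
  congr 2
  refine Multiset.map_congr rfl fun a _ => ?_
  have hRc : (R : ℂ) ≠ 0 := by exact_mod_cast hR.ne'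
  have : ((Polynomial.X - Polynomial.C a).comp (Polynomial.C (R : ℂ) * Polynomial.X)) =
      Polynomial.C (R : ℂ) * Polynomial.X + Polynomial.C (-a) := by
    simp [sub_eq_add_neg]
  simp only [Function.comp_apply, this]
  rw [Polynomial.mahlerMeasure_C_mul_X_add_C hRc, norm_neg, Complex.norm_real, Real.norm_of_nonneg hR.le]

/-- The mean of `log |p|` over the circle of radius `R` about the origin. -/
noncomputable def circleLogMean (p : Polynomial ℂ) (R : ℝ) : ℝ :=
  Real.circleAverage (fun z => Real.log ‖p.eval z‖) 0 R

/-- Jensen's formula for polynomials. -/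
lemma circleLogMean_eq {p : Polynomial ℂ} (hp : p ≠ 0) {R : ℝ} (hR : 0 < R) :
    circleLogMean p R =
      Real.log ‖p.leadingCoeff‖ + (p.roots.map (fun a => Real.log (max R ‖a‖))).sum := by
  have h1 : circleLogMean p R =
      (p.comp (Polynomial.C (R : ℂ) * Polynomial.X)).logMahlerMeasure := by
    rw [circleLogMean, Real.circleAverage_eq_circleAverage_zero_one, Polynomial.logMahlerMeasure_def]
    simp
  rw [h1, Polynomial.logMahlerMeasure_eq_log_MahlerMeasure, mahlerMeasure_comp_C_mul_X hR,
    Real.log_mul (by simpa using hp)]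
  · congr 1
    generalize p.roots = s
    induction s using Multiset.induction with
    | empty => simp
    | cons a s ih =>
      rw [Multiset.map_cons, Multiset.map_cons, Multiset.prod_cons, Multiset.sum_cons,
        Real.log_mul, ih]
      · exact (lt_max_of_lt_left hR).ne'
      · refine (Multiset.prod_pos fun y hy => ?_).ne'
        obtain ⟨a, -, rfl⟩ := Multiset.mem_map.1 hy
        exact lt_max_of_lt_left hR
  · refine (Multiset.prod_pos fun y hy => ?_).ne'
    obtain ⟨a, -, rfl⟩ := Multiset.mem_map.1 hy
    exact lt_max_of_lt_left hR

lemma circleLogMean_zero (R : ℝ) : circleLogMean 0 R = 0 := by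
  simp [circleLogMean, Real.circleAverage_def]

lemma card_filter_mul_log_le {s : Multiset ℂ} {r R : ℝ} (hr : 0 < r) (hrR : r ≤ R) :
    ((s.filter (fun z => ‖z‖ ≤ r)).card : ℝ) * Real.log (R / r) ≤
      (s.map (fun a => Real.log (max R ‖a‖))).sum - (s.map (fun a => Real.log (max r ‖a‖))).sum ∧
    (s.map (fun a => Real.log (max R ‖a‖))).sum - (s.map (fun a => Real.log (max r ‖a‖))).sum ≤
      ((s.filter (fun z => ‖z‖ ≤ R)).card : ℝ) * Real.log (R / r) := by
  have hR : 0 < R := hr.trans_le hrR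
  induction s using Multiset.induction with
  | empty => simp
  | cons a s ih =>
    have hlog : 0 ≤ Real.log (R / r) := Real.log_nonneg ((one_le_div hr).2 hrR)
    have hdiv : Real.log (R / r) = Real.log R - Real.log r := Real.log_div hR.ne' hr.ne'
    simp only [Multiset.map_cons, Multiset.sum_cons, Multiset.filter_cons, Multiset.card_add]
    rcases le_or_gt ‖a‖ r with h | h
    · rw [if_pos h, if_pos (h.trans hrR), max_eq_left h, max_eq_left (h.trans hrR)]
      push_cast [Multiset.card_singleton]
      constructor <;> linarith [ih.1, ih.2]
    · rw [if_neg (not_le.2 h), max_eq_right h.le]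
      rcases le_or_gt ‖a‖ R with h' | h'
      · rw [if_pos h', max_eq_left h']
        have h1 : Real.log r ≤ Real.log ‖a‖ := Real.log_le_log hr h.le
        have h2 : Real.log ‖a‖ ≤ Real.log R := Real.log_le_log (hr.trans h) h'
        push_cast [Multiset.card_singleton, Multiset.card_zero]
        constructor <;> linarith [ih.1, ih.2]
      · rw [if_neg (not_le.2 h'), max_eq_right h'.le]
        push_cast [Multiset.card_zero]
        constructor <;> linarith [ih.1, ih.2]

lemma zeroCount_mul_log_le (p : Polynomial ℂ) {r R : ℝ} (hr : 0 < r) (hrR : r ≤ R) :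
    (zeroCount p (r ^ 2) : ℝ) * Real.log (R / r) ≤ circleLogMean p R - circleLogMean p r ∧
    circleLogMean p R - circleLogMean p r ≤ (zeroCount p (R ^ 2) : ℝ) * Real.log (R / r) := by
  rcases eq_or_ne p 0 with rfl | hp
  · simp [zeroCount_zero, circleLogMean_zero]
  rw [circleLogMean_eq hp hr, circleLogMean_eq hp (hr.trans_le hrR), zeroCount_sq _ hr.le,
    zeroCount_sq _ (hr.le.trans hrR)]
  have := card_filter_mul_log_le (s := p.roots) hr hrR
  constructor <;> linarith [this.1, this.2]

lemma eventually_zeroCount_sq_eq (p : Polynomial ℂ) {r : ℝ} (hr : 0 < r) :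
    ∀ᶠ R in 𝓝[>] r, zeroCount p (R ^ 2) = zeroCount p (r ^ 2) := by
  have h : ∀ᶠ R in 𝓝[>] r, ∀ z ∈ p.roots.toFinset, (‖z‖ ≤ R ↔ ‖z‖ ≤ r) := by
    refine (Filter.eventually_all_finset _).2 fun z _ => ?_
    rcases le_or_gt ‖z‖ r with h | h
    · filter_upwards [self_mem_nhdsWithin] with R hR
      exact iff_of_true (h.trans (le_of_lt hR)) h
    · filter_upwards [mem_nhdsWithin_of_mem_nhds (Iio_mem_nhds h)] with R hR
      exact iff_of_false (not_le.2 hR) (not_le.2 h)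
  filter_upwards [h, self_mem_nhdsWithin] with R hR hrR
  rw [zeroCount_sq _ hr.le, zeroCount_sq _ (hr.le.trans (le_of_lt hrR))]
  congr 1
  exact Multiset.filter_congr fun z hz => hR z (Multiset.mem_toFinset.2 hz)

lemma tendsto_circleLogMean_sub_div_log (p : Polynomial ℂ) {r : ℝ} (hr : 0 < r) :
    Tendsto (fun R => (circleLogMean p R - circleLogMean p r) / Real.log (R / r)) (𝓝[>] r)
      (𝓝 (zeroCount p (r ^ 2))) := by
  refine tendsto_const_nhds.congr' ?_
  filter_upwards [eventually_zeroCount_sq_eq p hr, self_mem_nhdsWithin] with R hR hrR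
  have hlog : 0 < Real.log (R / r) := Real.log_pos ((one_lt_div hr).2 hrR)
  have := zeroCount_mul_log_le p hr (le_of_lt hrR)
  rw [hR] at this
  rw [eq_div_iff hlog.ne']
  exact le_antisymm this.1 this.2

lemma eval_poly (L N : ℕ) (c : Fin (N + 1) → ℂ) (z : ℂ) :
    (poly L N c).eval z =
      ∑ m : Fin (N + 1), (((√((m + L - 1).choose m : ℝ) : ℝ) : ℂ) * z ^ (m : ℕ)) * c m := by
  simp only [poly, Polynomial.eval_finsetSum, Polynomial.eval_monomial]
  exact Finset.sum_congr rfl fun m _ => by ring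

lemma continuous_eval_poly (L N : ℕ) :
    Continuous fun q : (Fin (N + 1) → ℂ) × ℂ => (poly L N q.1).eval q.2 := by
  simp only [eval_poly]
  fun_prop

lemma measurable_log_norm_eval_poly (L N : ℕ) :
    Measurable fun q : (Fin (N + 1) → ℂ) × ℂ => Real.log ‖(poly L N q.1).eval q.2‖ :=
  Real.measurable_log.comp (continuous_eval_poly L N).norm.measurable

lemma measurable_circleMap (c : ℂ) (R : ℝ) : Measurable (circleMap c R) :=
  (continuous_circleMap c R).measurable

lemma measurable_circleLogMean_poly (L N : ℕ) (R : ℝ) :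
    Measurable fun c : Fin (N + 1) → ℂ => circleLogMean (poly L N c) R := by
  simp only [circleLogMean, Real.circleAverage_def,
    intervalIntegral.integral_of_le Real.two_pi_pos.le, smul_eq_mul]
  have h : Measurable fun q : (Fin (N + 1) → ℂ) × ℝ =>
      Real.log ‖(poly L N q.1).eval (circleMap 0 R q.2)‖ :=
    (measurable_log_norm_eval_poly L N).comp
    (measurable_fst.prodMk ((measurable_circleMap 0 R).comp measurable_snd))
  exact (h.stronglyMeasurable.integral_prod_right'
    (ν := volume.restrict (Set.Ioc 0 (2 * Real.pi)))).measurable.const_mul _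

lemma measurable_zeroCount_poly_of_pos (L N : ℕ) {x : ℝ} (hx : 0 < x) :
    Measurable fun c : Fin (N + 1) → ℂ => (zeroCount (poly L N c) x : ℝ) := by
  obtain ⟨r, hr, rfl⟩ : ∃ r : ℝ, 0 < r ∧ r ^ 2 = x :=
    ⟨√x, Real.sqrt_pos.2 hx, Real.sq_sqrt hx.le⟩
  obtain ⟨u, -, hu, hlim⟩ := exists_seq_strictAnti_tendsto' (show r < r + 1 by linarith)
  have hlim' : Tendsto u atTop (𝓝[>] r) :=
    tendsto_nhdsWithin_iff.2 ⟨hlim, Eventually.of_forall fun n => (hu n).1⟩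
  refine measurable_of_tendsto_metrizable (f := fun n c =>
    (circleLogMean (poly L N c) (u n) - circleLogMean (poly L N c) r) / Real.log (u n / r))
    (fun n => ?_) ?_
  · exact ((measurable_circleLogMean_poly L N _).sub
      (measurable_circleLogMean_poly L N _)).div_const _
  · exact tendsto_pi_nhds.2 fun c => (tendsto_circleLogMean_sub_div_log _ hr).comp hlim'

lemma coeff_poly (L N : ℕ) (c : Fin (N + 1) → ℂ) (m : Fin (N + 1)) :
    (poly L N c).coeff m = ((√((m + L - 1).choose m : ℝ) : ℝ) : ℂ) * c m := by
  simp only [poly, Polynomial.finsetSum_coeff, Polynomial.coeff_monomial, Fin.val_inj]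
  simp

lemma natDegree_poly_le (L N : ℕ) (c : Fin (N + 1) → ℂ) : (poly L N c).natDegree ≤ N := by
  refine Polynomial.natDegree_sum_le_of_forall_le _ _ fun m _ => ?_
  exact (Polynomial.natDegree_monomial_le _).trans (Nat.le_of_lt_succ m.2)

lemma zeroCount_poly_le (L N : ℕ) (c : Fin (N + 1) → ℂ) (x : ℝ) :
    zeroCount (poly L N c) x ≤ N :=
  (zeroCount_le_natDegree _ _).trans (natDegree_poly_le _ _ _)

lemma zeroCount_poly_zero_eq_zero (L N : ℕ) {c : Fin (N + 1) → ℂ} (hc : c 0 ≠ 0) :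
    zeroCount (poly L N c) 0 = 0 := by
  unfold zeroCount
  rw [Multiset.card_eq_zero, Multiset.filter_eq_nil]
  intro z hz h
  have hz0 : z = 0 := by
    have : ‖z‖ ^ 2 = 0 := le_antisymm h (by positivity)
    simpa using this
  subst hz0
  have h0 := coeff_poly L N c 0
  have hroot := Polynomial.isRoot_of_mem_roots hz
  rw [Polynomial.IsRoot.def, ← Polynomial.coeff_zero_eq_eval_zero] at hroot
  rw [Fin.val_zero, hroot] at h0
  simp at h0
  exact hc h0.symm

instance : IsProbabilityMeasure stdComplexGaussian :=
  Measure.isProbabilityMeasure_map (Complex.measurableEquivRealProd.symm.measurable.aemeasurable)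

lemma integral_stdComplexGaussian {E : Type*} [NormedAddCommGroup E] [NormedSpace ℝ E]
    (f : ℂ → E) :
    ∫ z, f z ∂stdComplexGaussian =
      ∫ p : ℝ × ℝ, f ⟨p.1, p.2⟩
        ∂((gaussianReal 0 (1 / 2 : ℝ≥0)).prod (gaussianReal 0 (1 / 2 : ℝ≥0))) := by
  rw [stdComplexGaussian,
    Complex.measurableEquivRealProd.symm.measurableEmbedding.integral_map]
  rfl

lemma integrable_stdComplexGaussian_iff {E : Type*} [NormedAddCommGroup E] {f : ℂ → E} :
    Integrable f stdComplexGaussian ↔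
      Integrable (fun p : ℝ × ℝ => f ⟨p.1, p.2⟩)
        ((gaussianReal 0 (1 / 2 : ℝ≥0)).prod (gaussianReal 0 (1 / 2 : ℝ≥0))) := by
  rw [stdComplexGaussian, MeasurableEmbedding.integrable_map_iff
    Complex.measurableEquivRealProd.symm.measurableEmbedding]
  rfl

lemma charFun_stdComplexGaussian (t : ℂ) :
    charFun stdComplexGaussian t = Complex.exp (-(‖t‖ ^ 2 / 4 : ℝ)) := by
  rw [charFun_apply, integral_stdComplexGaussian]
  have h : ∀ p : ℝ × ℝ, Complex.exp ((inner ℝ (⟨p.1, p.2⟩ : ℂ) t : ℝ) * Complex.I) =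
      Complex.exp ((t.re : ℂ) * p.1 * Complex.I) * Complex.exp ((t.im : ℂ) * p.2 * Complex.I) := by
    intro p
    rw [← Complex.exp_add]
    congr 1
    simp [Complex.inner]
    ring
  simp_rw [h]
  rw [integral_prod_mul (fun x : ℝ => Complex.exp ((t.re : ℂ) * x * Complex.I))
    (fun y : ℝ => Complex.exp ((t.im : ℂ) * y * Complex.I)), ← charFun_apply_real,
    ← charFun_apply_real, charFun_gaussianReal, charFun_gaussianReal, ← Complex.exp_add]
  congr 1
  rw [Complex.sq_norm, Complex.normSq_apply]
  push_cast
  simp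
  ring

lemma charFun_map_mul_left (μ : Measure ℂ) (c t : ℂ) :
    charFun (μ.map (fun z => c * z)) t = charFun μ (starRingEnd ℂ c * t) := by
  rw [charFun_apply, charFun_apply, integral_map (by fun_prop) (by fun_prop)]
  congr 1
  ext z
  congr 3
  simp [Complex.inner]
  ring

lemma IsStdComplexGaussianFamily.map_sum_mul {ι Ω : Type*} [Fintype ι] [MeasurableSpace Ω]
    {μ : Measure Ω} [IsProbabilityMeasure μ] {a : ι → Ω → ℂ}
    (ha : IsStdComplexGaussianFamily μ a) (c : ι → ℂ) :
    μ.map (fun ω => ∑ i, c i * a i ω) =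
      stdComplexGaussian.map (fun z => ((√(∑ i, ‖c i‖ ^ 2) : ℝ) : ℂ) * z) := by
  have hm : ∀ i, AEMeasurable (a i) μ := fun i => (ha.hasLaw i).aemeasurable
  have hmc : ∀ i, AEMeasurable (fun ω => c i * a i ω) μ := fun i => (hm i).const_mul _
  have hind : iIndepFun (fun i ω => c i * a i ω) μ :=
    ha.indep.comp (fun i z => c i * z) fun i => by fun_prop
  have : IsProbabilityMeasure (stdComplexGaussian.map
      (fun z => ((√(∑ i, ‖c i‖ ^ 2) : ℝ) : ℂ) * z)) :=
    Measure.isProbabilityMeasure_map (by fun_prop)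
  have : IsProbabilityMeasure (μ.map (fun ω => ∑ i, c i * a i ω)) :=
    Measure.isProbabilityMeasure_map (by fun_prop)
  refine Measure.ext_of_charFun (funext fun t => ?_)
  rw [hind.charFun_map_fun_sum_eq_prod hmc, charFun_map_mul_left, charFun_stdComplexGaussian,
    Finset.prod_apply]
  have h : ∀ i, charFun (μ.map fun ω => c i * a i ω) t =
      Complex.exp (-(‖c i‖ ^ 2 * ‖t‖ ^ 2 / 4 : ℝ)) := by
    intro i
    have : μ.map (fun ω => c i * a i ω) = (μ.map (a i)).map (fun z => c i * z) :=
      (AEMeasurable.map_map_of_aemeasurable (by fun_prop) (hm i)).symm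
    rw [this, (ha.hasLaw i).map_eq, charFun_map_mul_left, charFun_stdComplexGaussian, norm_mul,
      RCLike.norm_conj, mul_pow]
  simp_rw [h]
  rw [← Complex.exp_sum]
  congr 1
  rw [norm_mul, RCLike.norm_conj, mul_pow, Complex.norm_real, Real.norm_eq_abs, sq_abs,
    Real.sq_sqrt (Finset.sum_nonneg fun i _ => by positivity), Finset.sum_mul, Finset.sum_div]
  push_cast
  rw [Finset.sum_neg_distrib]

lemma integrable_log_abs_gaussianReal (v : ℝ≥0) :
    Integrable (fun x : ℝ => Real.log |x|) (gaussianReal 0 v) := by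
  rcases eq_or_ne v 0 with rfl | hv
  · simp [integrable_dirac]
  have hid : Integrable (fun x : ℝ => |x|) (gaussianReal 0 v) :=
    ((memLp_id_gaussianReal 1).integrable le_rfl).abs
  have hloc : Integrable (fun x : ℝ => (Set.Icc (-1 : ℝ) 1).indicator Real.log x)
      (gaussianReal 0 v) := by
    rw [gaussianReal_of_var_ne_zero _ hv,
      integrable_withDensity_iff_integrable_smul' (measurable_gaussianPDF 0 v)
        (Eventually.of_forall fun x => gaussianPDF_lt_top)]
    have h1 : Integrable ((Set.Icc (-1 : ℝ) 1).indicator Real.log) volume := by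
      rw [integrable_indicator_iff measurableSet_Icc, ← intervalIntegrable_iff_integrableOn_Icc_of_le
        (by norm_num)]
      exact intervalIntegral.intervalIntegrable_log'
    simp only [smul_eq_mul]
    refine h1.bdd_mul (c := (√(2 * Real.pi * v))⁻¹) ?_ ?_
    · exact (measurable_gaussianPDF 0 v).ennreal_toReal.aestronglyMeasurable
    · refine Eventually.of_forall fun x => ?_
      rw [toReal_gaussianPDF, Real.norm_of_nonneg (gaussianPDFReal_nonneg _ _ _), gaussianPDFReal]
      refine mul_le_of_le_one_right (by positivity) (Real.exp_le_one_iff.2 ?_)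
      rw [neg_div]
      exact neg_nonpos.2 (by positivity)
  refine (hid.add hloc.abs).mono'
    (Real.measurable_log.comp (measurable_norm (α := ℝ))).aestronglyMeasurable (Eventually.of_forall fun x => ?_)
  simp only [Real.log_abs, Real.norm_eq_abs, Pi.add_apply]
  by_cases hx : x ∈ Set.Icc (-1 : ℝ) 1
  · rw [Set.indicator_of_mem hx]
    linarith [abs_nonneg x]
  · rw [Set.indicator_of_notMem hx, abs_zero, add_zero, ← Real.log_abs]
    have h1 : 1 ≤ |x| := by
      by_contra h
      exact hx (Set.mem_Icc.2 (abs_le.1 (not_le.1 h).le))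
    rw [abs_of_nonneg (Real.log_nonneg h1)]
    linarith [Real.log_le_sub_one_of_pos (zero_lt_one.trans_le h1)]

lemma ae_fst_ne_zero_gaussianReal_prod :
    ∀ᵐ p ∂((gaussianReal 0 (1 / 2 : ℝ≥0)).prod (gaussianReal 0 (1 / 2 : ℝ≥0))), p.1 ≠ 0 := by
  have := nullSingletonClass_gaussianReal (μ := 0) (v := (1 / 2 : ℝ≥0)) (by norm_num)
  exact Measure.quasiMeasurePreserving_fst.ae (Measure.ae_ne _ 0)

lemma ae_ne_zero_stdComplexGaussian : ∀ᵐ z ∂stdComplexGaussian, z ≠ 0 := by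
  rw [stdComplexGaussian, Complex.measurableEquivRealProd.symm.measurableEmbedding.ae_map_iff]
  filter_upwards [ae_fst_ne_zero_gaussianReal_prod] with p hp h
  exact hp (congrArg Complex.re h)

lemma integrable_log_norm_stdComplexGaussian :
    Integrable (fun z : ℂ => Real.log ‖z‖) stdComplexGaussian := by
  have hid : Integrable (fun x : ℝ => |x|) (gaussianReal 0 (1 / 2 : ℝ≥0)) :=
    ((memLp_id_gaussianReal 1).integrable le_rfl).abs
  rw [integrable_stdComplexGaussian_iff]
  have hb : Integrable (fun p : ℝ × ℝ => |Real.log (|p.1|)| + |p.1| + |p.2|)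
      ((gaussianReal 0 (1 / 2 : ℝ≥0)).prod (gaussianReal 0 (1 / 2 : ℝ≥0))) :=
    (((integrable_log_abs_gaussianReal _).abs.comp_fst _).add (hid.comp_fst _)).add
      (hid.comp_snd _)
  refine hb.mono' ?_ ?_
  · have h1 : Measurable fun p : ℝ × ℝ => (⟨p.1, p.2⟩ : ℂ) :=
      Complex.measurableEquivRealProd.symm.measurable
    exact (Real.measurable_log.comp (measurable_norm.comp h1)).aestronglyMeasurable
  · filter_upwards [ae_fst_ne_zero_gaussianReal_prod] with p hp
    have hre : |p.1| ≤ ‖(⟨p.1, p.2⟩ : ℂ)‖ := Complex.abs_re_le_norm ⟨p.1, p.2⟩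
    have hpos : 0 < |p.1| := abs_pos.2 hp
    have hup : ‖(⟨p.1, p.2⟩ : ℂ)‖ ≤ |p.1| + |p.2| := Complex.norm_le_abs_re_add_abs_im ⟨p.1, p.2⟩
    rw [Real.norm_eq_abs, abs_le]
    constructor
    · have := Real.log_le_log hpos hre
      linarith [neg_abs_le (Real.log |p.1|), abs_nonneg p.2]
    · have := Real.log_le_sub_one_of_pos (hpos.trans_le hre)
      linarith [abs_nonneg (Real.log |p.1|)]

/-- The covariance kernel `∑_{m=0}^N C(m+L-1, m) x^m` on the diagonal, with `x = |z|^2`. -/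
noncomputable def kernelSum (L N : ℕ) (x : ℝ) : ℝ :=
  ∑ m ∈ Finset.range (N + 1), ((m + L - 1).choose m : ℝ) * x ^ m

/-- The function `x * K'(x)`, where `K` is the kernel `kernelSum L N`. -/
noncomputable def kernelMoment (L N : ℕ) (x : ℝ) : ℝ :=
  ∑ m ∈ Finset.range (N + 1), (m : ℝ) * (((m + L - 1).choose m : ℝ) * x ^ m)

lemma kernelSum_pos (L N : ℕ) {x : ℝ} (hx : 0 ≤ x) : 0 < kernelSum L N x := by
  refine Finset.sum_pos' (fun m _ => by positivity) ⟨0, by simp, by simp⟩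

lemma hasDerivAt_half_log_kernelSum_exp (L N : ℕ) (t : ℝ) :
    HasDerivAt (fun t => Real.log (kernelSum L N (Real.exp (2 * t))) / 2)
      (kernelMoment L N (Real.exp (2 * t)) / kernelSum L N (Real.exp (2 * t))) t := by
  have h1 : HasDerivAt (fun t => kernelSum L N (Real.exp (2 * t)))
      (2 * kernelMoment L N (Real.exp (2 * t))) t := by
    unfold kernelSum kernelMoment
    rw [Finset.mul_sum]
    refine HasDerivAt.fun_sum fun m _ => ?_
    have h2 : HasDerivAt (fun t : ℝ => Real.exp ((m : ℝ) * (2 * t)))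
        (Real.exp ((m : ℝ) * (2 * t)) * ((m : ℝ) * 2)) t := by
      have h3 := ((hasDerivAt_id t).const_mul 2).const_mul (m : ℝ)
      simp only [mul_one] at h3
      exact h3.exp
    simp_rw [← Real.exp_nat_mul]
    exact (h2.const_mul ((m + L - 1).choose m : ℝ)).congr_deriv (by ring)
  have hpos := kernelSum_pos L N (Real.exp_pos (2 * t)).le
  exact ((h1.log hpos.ne').div_const 2).congr_deriv (by ring)

section Family

variable {Ω : Type*} [MeasurableSpace Ω] {μ : Measure Ω} {L N : ℕ}
  {a : Fin (N + 1) → Ω → ℂ}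

lemma IsStdComplexGaussianFamily.aemeasurable (ha : IsStdComplexGaussianFamily μ a) :
    AEMeasurable (fun ω m => a m ω) μ :=
  aemeasurable_pi_lambda _ fun m => (ha.hasLaw m).aemeasurable

lemma IsStdComplexGaussianFamily.aemeasurable_eval (ha : IsStdComplexGaussianFamily μ a) (z : ℂ) :
    AEMeasurable (fun ω => (poly L N (fun m => a m ω)).eval z) μ := by
  simp only [eval_poly]
  have := fun m => (ha.hasLaw m).aemeasurable
  fun_prop

variable [IsProbabilityMeasure μ]

lemma IsStdComplexGaussianFamily.map_eval_poly (ha : IsStdComplexGaussianFamily μ a) (z : ℂ) :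
    μ.map (fun ω => (poly L N (fun m => a m ω)).eval z) =
      stdComplexGaussian.map (fun w => ((√(kernelSum L N (‖z‖ ^ 2)) : ℝ) : ℂ) * w) := by
  simp only [eval_poly]
  rw [ha.map_sum_mul]
  congr! 5
  rw [kernelSum, ← Fin.sum_univ_eq_sum_range (fun m => ((m + L - 1).choose m : ℝ) * (‖z‖ ^ 2) ^ m)]
  refine Finset.sum_congr rfl fun m _ => ?_
  rw [norm_mul, mul_pow, Complex.norm_real, Real.norm_eq_abs, sq_abs,
    Real.sq_sqrt (Nat.cast_nonneg _), norm_pow, ← pow_mul, ← pow_mul, mul_comm (m : ℕ) 2]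

lemma IsStdComplexGaussianFamily.integral_comp_eval (ha : IsStdComplexGaussianFamily μ a) (z : ℂ)
    {F : ℂ → ℝ} (hF : Measurable F) :
    ∫ ω, F ((poly L N (fun m => a m ω)).eval z) ∂μ =
      ∫ w, F (((√(kernelSum L N (‖z‖ ^ 2)) : ℝ) : ℂ) * w) ∂stdComplexGaussian := by
  rw [← integral_map (ha.aemeasurable_eval z) hF.aestronglyMeasurable, ha.map_eval_poly,
    integral_map (by fun_prop) hF.aestronglyMeasurable]

lemma log_norm_mul_ae_eq {c : ℝ} (hc : 0 < c) :
    (fun w : ℂ => Real.log ‖(c : ℂ) * w‖) =ᵐ[stdComplexGaussian]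
      fun w => Real.log c + Real.log ‖w‖ := by
  filter_upwards [ae_ne_zero_stdComplexGaussian] with w hw
  rw [norm_mul, Complex.norm_real, Real.norm_of_nonneg hc.le,
    Real.log_mul hc.ne' (norm_ne_zero_iff.2 hw)]

lemma measurable_log_norm : Measurable fun z : ℂ => Real.log ‖z‖ :=
  Real.measurable_log.comp measurable_norm

lemma IsStdComplexGaussianFamily.integrable_log_norm_eval (ha : IsStdComplexGaussianFamily μ a)
    (z : ℂ) : Integrable (fun ω => Real.log ‖(poly L N (fun m => a m ω)).eval z‖) μ := by
  have hc : 0 < √(kernelSum L N (‖z‖ ^ 2)) := Real.sqrt_pos.2 (kernelSum_pos L N (by positivity))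
  have h : Integrable (fun z : ℂ => Real.log ‖z‖)
      (μ.map (fun ω => (poly L N (fun m => a m ω)).eval z)) := by
    rw [ha.map_eval_poly, integrable_map_measure measurable_log_norm.aestronglyMeasurable
      (by fun_prop)]
    refine Integrable.congr ?_ (log_norm_mul_ae_eq hc).symm
    exact (integrable_const _).add integrable_log_norm_stdComplexGaussian
  exact (integrable_map_measure measurable_log_norm.aestronglyMeasurable
    (ha.aemeasurable_eval z)).1 h

lemma IsStdComplexGaussianFamily.integral_log_norm_eval (ha : IsStdComplexGaussianFamily μ a)
    (z : ℂ) : ∫ ω, Real.log ‖(poly L N (fun m => a m ω)).eval z‖ ∂μ =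
      Real.log (kernelSum L N (‖z‖ ^ 2)) / 2 + ∫ w, Real.log ‖w‖ ∂stdComplexGaussian := by
  have hK := kernelSum_pos L N (x := ‖z‖ ^ 2) (by positivity)
  rw [ha.integral_comp_eval z measurable_log_norm,
    integral_congr_ae (log_norm_mul_ae_eq (Real.sqrt_pos.2 hK)),
    integral_add (integrable_const _) integrable_log_norm_stdComplexGaussian,
    integral_const, Real.log_sqrt hK.le]
  simp

lemma norm_circleMap_zero_of_nonneg {R : ℝ} (hR : 0 ≤ R) (θ : ℝ) : ‖circleMap 0 R θ‖ = R := by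
  rw [norm_circleMap_zero, abs_of_nonneg hR]

lemma IsStdComplexGaussianFamily.integrable_prod_log_norm_eval
    (ha : IsStdComplexGaussianFamily μ a) {R : ℝ} (hR : 0 ≤ R) :
    Integrable
      (fun q : Ω × ℝ => Real.log ‖(poly L N (fun m => a m q.1)).eval (circleMap 0 R q.2)‖)
      (μ.prod (volume.restrict (Set.Ioc 0 (2 * Real.pi)))) := by
  rw [integrable_prod_iff']
  · refine ⟨Eventually.of_forall fun θ => ha.integrable_log_norm_eval (circleMap 0 R θ), ?_⟩
    have h : ∀ θ : ℝ, ∫ ω, ‖Real.log ‖(poly L N (fun m => a m ω)).eval (circleMap 0 R θ)‖‖ ∂μ =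
        ∫ w, ‖Real.log ‖((√(kernelSum L N (R ^ 2)) : ℝ) : ℂ) * w‖‖ ∂stdComplexGaussian := by
      intro θ
      rw [ha.integral_comp_eval (circleMap 0 R θ) (F := fun z => ‖Real.log ‖z‖‖)
        measurable_log_norm.norm, norm_circleMap_zero_of_nonneg hR]
    simp only [h]
    exact integrable_const _
  · have h1 : AEMeasurable (fun q : Ω × ℝ => ((fun m => a m q.1), circleMap 0 R q.2))
        (μ.prod (volume.restrict (Set.Ioc 0 (2 * Real.pi)))) :=
      AEMeasurable.prodMk (ha.aemeasurable.comp_fst)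
        ((measurable_circleMap 0 R).comp measurable_snd).aemeasurable
    exact ((measurable_log_norm_eval_poly L N).comp_aemeasurable h1).aestronglyMeasurable

lemma circleLogMean_eq_setIntegral (p : Polynomial ℂ) (R : ℝ) :
    circleLogMean p R = (2 * Real.pi)⁻¹ *
      ∫ θ in Set.Ioc 0 (2 * Real.pi), Real.log ‖p.eval (circleMap 0 R θ)‖ := by
  rw [circleLogMean, Real.circleAverage_def, intervalIntegral.integral_of_le Real.two_pi_pos.le,
    smul_eq_mul]

lemma IsStdComplexGaussianFamily.integrable_circleLogMean
    (ha : IsStdComplexGaussianFamily μ a) {R : ℝ} (hR : 0 ≤ R) :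
    Integrable (fun ω => circleLogMean (poly L N (fun m => a m ω)) R) μ := by
  simp only [circleLogMean_eq_setIntegral]
  exact (ha.integrable_prod_log_norm_eval hR).integral_prod_left.const_mul _

lemma IsStdComplexGaussianFamily.integral_circleLogMean
    (ha : IsStdComplexGaussianFamily μ a) {R : ℝ} (hR : 0 ≤ R) :
    ∫ ω, circleLogMean (poly L N (fun m => a m ω)) R ∂μ =
      Real.log (kernelSum L N (R ^ 2)) / 2 + ∫ w, Real.log ‖w‖ ∂stdComplexGaussian := by
  simp only [circleLogMean_eq_setIntegral]
  rw [integral_const_mul, integral_integral_swap (ha.integrable_prod_log_norm_eval hR)]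
  simp only [ha.integral_log_norm_eval, norm_circleMap_zero_of_nonneg hR]
  rw [setIntegral_const, Real.volume_real_Ioc_of_le Real.two_pi_pos.le, smul_eq_mul, sub_zero,
    inv_mul_cancel_left₀ Real.two_pi_pos.ne']

lemma IsStdComplexGaussianFamily.integrable_zeroCount
    (ha : IsStdComplexGaussianFamily μ a) (x : ℝ) :
    Integrable (fun ω => (zeroCount (poly L N (fun m => a m ω)) x : ℝ)) μ := by
  rcases lt_trichotomy x 0 with hx | rfl | hx
  · simp [zeroCount_of_neg _ hx]
  · have h0 : ∀ᵐ ω ∂μ, a 0 ω ≠ 0 := by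
      refine ae_of_ae_map (p := fun z : ℂ => z ≠ 0) (ha.hasLaw 0).aemeasurable ?_
      rw [(ha.hasLaw 0).map_eq]
      exact ae_ne_zero_stdComplexGaussian
    refine (integrable_zero Ω ℝ μ).congr ?_
    filter_upwards [h0] with ω hω
    rw [zeroCount_poly_zero_eq_zero L N hω, Nat.cast_zero, Pi.zero_apply]
  · refine Integrable.of_bound (C := N) ?_ (Eventually.of_forall fun ω => ?_)
    · exact ((measurable_zeroCount_poly_of_pos L N hx).comp_aemeasurable
        ha.aemeasurable).aestronglyMeasurable
    · rw [Real.norm_natCast]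
      exact_mod_cast zeroCount_poly_le L N _ x

lemma IsStdComplexGaussianFamily.integral_zeroCount_mul_sub_le
    (ha : IsStdComplexGaussianFamily μ a) {s t : ℝ} (hst : s ≤ t) :
    (∫ ω, (zeroCount (poly L N (fun m => a m ω)) (Real.exp (2 * s)) : ℝ) ∂μ) * (t - s) ≤
      Real.log (kernelSum L N (Real.exp (2 * t))) / 2 -
        Real.log (kernelSum L N (Real.exp (2 * s))) / 2 ∧
    Real.log (kernelSum L N (Real.exp (2 * t))) / 2 -
        Real.log (kernelSum L N (Real.exp (2 * s))) / 2 ≤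
    (∫ ω, (zeroCount (poly L N (fun m => a m ω)) (Real.exp (2 * t)) : ℝ) ∂μ) * (t - s) := by
  have hsq : ∀ u : ℝ, Real.exp (2 * u) = Real.exp u ^ 2 := fun u => by
    rw [← Real.exp_nat_mul]; norm_num
  have hint := fun u : ℝ => ha.integrable_circleLogMean (L := L) (Real.exp_pos u).le
  have hG : Real.log (kernelSum L N (Real.exp (2 * t))) / 2 -
      Real.log (kernelSum L N (Real.exp (2 * s))) / 2 =
      ∫ ω, (circleLogMean (poly L N (fun m => a m ω)) (Real.exp t) -
        circleLogMean (poly L N (fun m => a m ω)) (Real.exp s)) ∂μ := by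
    rw [integral_sub (hint t) (hint s), ha.integral_circleLogMean (Real.exp_pos t).le,
      ha.integral_circleLogMean (Real.exp_pos s).le, hsq, hsq]
    ring
  have hlog : Real.log (Real.exp t / Real.exp s) = t - s := by rw [← Real.exp_sub, Real.log_exp]
  have hb := fun ω => zeroCount_mul_log_le (poly L N (fun m => a m ω)) (Real.exp_pos s)
    (Real.exp_le_exp.2 hst)
  rw [hG, ← integral_mul_const, ← integral_mul_const]
  constructor
  · refine integral_mono ((ha.integrable_zeroCount _).mul_const _) ((hint t).sub (hint s))
      fun ω => ?_
    simpa only [hlog, ← hsq] using (hb ω).1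
  · refine integral_mono ((hint t).sub (hint s)) ((ha.integrable_zeroCount _).mul_const _)
      fun ω => ?_
    simpa only [hlog, ← hsq] using (hb ω).2

/-- The expected number of zeros in the disk `|z|^2 ≤ x` is `x K'(x) / K(x)`. -/
theorem IsStdComplexGaussianFamily.integral_zeroCount
    (ha : IsStdComplexGaussianFamily μ a) {x : ℝ} (hx : 0 < x) :
    ∫ ω, (zeroCount (poly L N (fun m => a m ω)) x : ℝ) ∂μ =
      kernelMoment L N x / kernelSum L N x := by
  obtain ⟨t, rfl⟩ : ∃ t, Real.exp (2 * t) = x :=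
    ⟨Real.log x / 2, by rw [mul_div_cancel₀ _ two_ne_zero, Real.exp_log hx]⟩
  have hd := hasDerivAt_iff_tendsto_slope.1 (hasDerivAt_half_log_kernelSum_exp L N t)
  refine le_antisymm ?_ ?_
  · refine ge_of_tendsto (hd.mono_left (nhdsWithin_mono t fun y hy => ne_of_gt hy) :
      Tendsto _ (𝓝[>] t) _) ?_
    filter_upwards [self_mem_nhdsWithin] with T hT
    rw [slope_def_field, le_div_iff₀ (sub_pos.2 hT)]
    exact (ha.integral_zeroCount_mul_sub_le (le_of_lt hT)).1
  · refine le_of_tendsto (hd.mono_left (nhdsWithin_mono t fun y hy => ne_of_lt hy) :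
      Tendsto _ (𝓝[<] t) _) ?_
    filter_upwards [self_mem_nhdsWithin] with T hT
    rw [slope_comm, slope_def_field, div_le_iff₀ (sub_pos.2 hT)]
    exact (ha.integral_zeroCount_mul_sub_le (le_of_lt hT)).2

end Family

/-- The exponential moment `∫_0^1 t^j e^{st} dt`. -/
noncomputable def expMoment (j : ℕ) (s : ℝ) : ℝ := ∫ t in (0 : ℝ)..1, t ^ j * Real.exp (s * t)

lemma intervalIntegrable_pow_mul_exp (j : ℕ) (s a b : ℝ) :
    IntervalIntegrable (fun t : ℝ => t ^ j * Real.exp (s * t)) volume a b :=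
  (by fun_prop : Continuous fun t : ℝ => t ^ j * Real.exp (s * t)).intervalIntegrable a b

lemma hasDerivAt_expMoment (j : ℕ) (s : ℝ) :
    HasDerivAt (expMoment j) (expMoment (j + 1) s) s := by
  refine (intervalIntegral.hasDerivAt_integral_of_dominated_loc_of_deriv_le
    (F := fun s t : ℝ => t ^ j * Real.exp (s * t))
    (F' := fun s t : ℝ => t ^ (j + 1) * Real.exp (s * t))
    (bound := fun _ => Real.exp (|s| + 1)) (Metric.ball_mem_nhds s one_pos)
    (Eventually.of_forall fun x => Continuous.aestronglyMeasurable (by fun_prop))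
    (intervalIntegrable_pow_mul_exp j s 0 1) (Continuous.aestronglyMeasurable (by fun_prop))
    (Eventually.of_forall fun t ht x hx => ?_) (by simp)
    (Eventually.of_forall fun t ht x hx => ?_)).2
  · rw [Set.uIoc_of_le zero_le_one] at ht
    have hx' : x ≤ |s| + 1 := by
      have := (abs_lt.1 (Metric.mem_ball.1 hx)).2
      linarith [le_abs_self s]
    rw [Real.norm_of_nonneg (mul_nonneg (pow_nonneg ht.1.le _) (Real.exp_pos _).le)]
    refine (mul_le_of_le_one_left (Real.exp_pos _).le (pow_le_one₀ ht.1.le ht.2)).trans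
      (Real.exp_le_exp.2 ?_)
    have hs : 0 ≤ |s| + 1 := by positivity
    exact (mul_le_mul_of_nonneg_right hx' ht.1.le).trans (mul_le_of_le_one_right hs ht.2)
  · have h := (((hasDerivAt_id x).mul_const t).exp.const_mul (t ^ j))
    simp only [id, one_mul] at h
    exact h.congr_deriv (by ring)

lemma mul_expMoment_zero (s : ℝ) : s * expMoment 0 s = Real.exp s - 1 := by
  have h : ∀ t ∈ Set.uIcc (0 : ℝ) 1,
      HasDerivAt (fun t => Real.exp (s * t)) (s * (t ^ 0 * Real.exp (s * t))) t := by
    intro t _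
    have h := ((hasDerivAt_id t).const_mul s).exp
    simp only [id, mul_one] at h
    exact h.congr_deriv (by ring)
  rw [expMoment, ← intervalIntegral.integral_const_mul,
    intervalIntegral.integral_eq_sub_of_hasDerivAt h
      ((intervalIntegrable_pow_mul_exp 0 s 0 1).const_mul s)]
  simp

/-- Integration by parts for the exponential moments. -/
lemma mul_expMoment_succ (j : ℕ) (s : ℝ) :
    s * expMoment (j + 1) s = Real.exp s - (j + 1) * expMoment j s := by
  have h : ∀ t ∈ Set.uIcc (0 : ℝ) 1,
      HasDerivAt (fun t : ℝ => t ^ (j + 1) * Real.exp (s * t))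
        (((j : ℝ) + 1) * (t ^ j * Real.exp (s * t)) + s * (t ^ (j + 1) * Real.exp (s * t))) t := by
    intro t _
    have h := ((hasDerivAt_id t).const_mul s).exp
    simp only [id, mul_one] at h
    refine ((hasDerivAt_pow (j + 1) t).mul h).congr_deriv ?_
    push_cast
    ring
  have h1 := (intervalIntegrable_pow_mul_exp j s 0 1).const_mul ((j : ℝ) + 1)
  have h2 := (intervalIntegrable_pow_mul_exp (j + 1) s 0 1).const_mul s
  have h3 := intervalIntegral.integral_eq_sub_of_hasDerivAt h (h1.add h2)
  rw [intervalIntegral.integral_add h1 h2, intervalIntegral.integral_const_mul,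
    intervalIntegral.integral_const_mul] at h3
  simp only [one_pow, mul_one, one_mul, zero_pow j.succ_ne_zero, zero_mul, sub_zero] at h3
  simp only [expMoment]
  linarith

lemma expMoment_zero_right (j : ℕ) : expMoment j 0 = 1 / (j + 1) := by
  simp [expMoment, integral_pow]

lemma g_eq_expMoment_zero : g = expMoment 0 := by
  funext s
  rw [g]
  split_ifs with hs
  · rw [hs, expMoment_zero_right]
    simp
  · rw [← mul_expMoment_zero, mul_div_cancel_left₀ _ hs]

lemma iteratedDeriv_g (j : ℕ) : iteratedDeriv j g = expMoment j := by
  induction j with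
  | zero => rw [iteratedDeriv_zero, g_eq_expMoment_zero]
  | succ j ih =>
    rw [iteratedDeriv_succ, ih]
    funext s
    exact (hasDerivAt_expMoment j s).deriv

lemma differentiable_expMoment (j : ℕ) : Differentiable ℝ (expMoment j) :=
  fun s => (hasDerivAt_expMoment j s).differentiableAt

lemma contDiff_g : ContDiff ℝ (⊤ : ℕ∞) g := by
  refine contDiff_of_differentiable_iteratedDeriv fun m _ => ?_
  rw [iteratedDeriv_g]
  exact differentiable_expMoment m

lemma exp_neg_mul_pow_le_expMoment (j : ℕ) {s B δ : ℝ} (hδ : 0 ≤ δ) (hδ1 : δ ≤ 1) (hB : 0 ≤ B)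
    (hs : -B ≤ s * δ) :
    Real.exp (-B) * (δ ^ (j + 1) / (j + 1)) ≤ expMoment j s := by
  have h1 : ∫ t in (0 : ℝ)..δ, t ^ j * Real.exp (-B) = Real.exp (-B) * (δ ^ (j + 1) / (j + 1)) := by
    rw [intervalIntegral.integral_mul_const, integral_pow, mul_comm]
    simp
  have h2 : ∫ t in (0 : ℝ)..δ, t ^ j * Real.exp (-B) ≤
      ∫ t in (0 : ℝ)..δ, t ^ j * Real.exp (s * t) := by
    refine intervalIntegral.integral_mono_on hδ
      (Continuous.intervalIntegrable (by fun_prop) _ _) (intervalIntegrable_pow_mul_exp j s 0 δ)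
      fun t ht => ?_
    refine mul_le_mul_of_nonneg_left (Real.exp_le_exp.2 ?_) (pow_nonneg ht.1 _)
    rcases le_or_gt 0 s with h | h
    · exact (neg_nonpos.2 hB).trans (mul_nonneg h ht.1)
    · exact hs.trans (mul_le_mul_of_nonpos_left ht.2 h.le)
  have h3 : 0 ≤ ∫ t in δ..1, t ^ j * Real.exp (s * t) := by
    refine intervalIntegral.integral_nonneg hδ1 fun t ht => ?_
    exact mul_nonneg (pow_nonneg (hδ.trans ht.1) _) (Real.exp_pos _).le
  rw [expMoment, ← intervalIntegral.integral_add_adjacent_intervals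
    (intervalIntegrable_pow_mul_exp j s 0 δ) (intervalIntegrable_pow_mul_exp j s δ 1)]
  linarith

lemma exp_neg_div_le_expMoment (j : ℕ) {s A : ℝ} (hA : 0 ≤ A) (hs : -A ≤ s) :
    Real.exp (-A) / (j + 1) ≤ expMoment j s := by
  have := exp_neg_mul_pow_le_expMoment j (s := s) zero_le_one le_rfl hA (by rwa [mul_one])
  rwa [one_pow, mul_one_div] at this

lemma expMoment_pos (j : ℕ) (s : ℝ) : 0 < expMoment j s :=
  lt_of_lt_of_le (by positivity) (exp_neg_div_le_expMoment j (abs_nonneg s) (neg_abs_le s))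

lemma expMoment_succ_le (j : ℕ) (s : ℝ) : expMoment (j + 1) s ≤ expMoment j s := by
  refine intervalIntegral.integral_mono_on zero_le_one (intervalIntegrable_pow_mul_exp _ s 0 1)
    (intervalIntegrable_pow_mul_exp j s 0 1) fun t ht => ?_
  exact mul_le_mul_of_nonneg_right (pow_le_pow_of_le_one ht.1 ht.2 j.le_succ) (Real.exp_pos _).le

lemma limitFraction_succ (k : ℕ) (s : ℝ) :
    limitFraction (k + 1) s = expMoment (k + 1) s / expMoment k s := by
  rw [limitFraction, Nat.add_sub_cancel, iteratedDeriv_g, iteratedDeriv_g]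

lemma limitFraction_succ_mem_Icc (k : ℕ) (s : ℝ) :
    limitFraction (k + 1) s ∈ Set.Icc (0 : ℝ) 1 := by
  rw [limitFraction_succ]
  exact ⟨(div_pos (expMoment_pos _ _) (expMoment_pos _ _)).le,
    (div_le_one (expMoment_pos _ _)).2 (expMoment_succ_le k s)⟩

lemma limitFraction_succ_zero (k : ℕ) :
    limitFraction (k + 1) 0 = ((k + 1 : ℕ) : ℝ) / ((k + 1 : ℕ) + 1) := by
  rw [limitFraction_succ, expMoment_zero_right, expMoment_zero_right]
  push_cast
  field_simp

lemma limitFraction_succ_add (k : ℕ) {s : ℝ} (hs : s ≠ 0) :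
    limitFraction (k + 1) s + (k + 1) / s = Real.exp s / (s * expMoment k s) := by
  have hpos := (expMoment_pos k s).ne'
  rw [limitFraction_succ, div_add_div _ _ hpos hs, div_eq_div_iff (by positivity) (by positivity)]
  linear_combination (s * expMoment k s) * mul_expMoment_succ k s

lemma limitFraction_isBigO_atBot (k : ℕ) :
    (fun s : ℝ => limitFraction (k + 1) s - (-((k + 1 : ℕ) : ℝ) / s)) =O[atBot]
      (fun s : ℝ => (-s) ^ k * Real.exp s) := by
  refine IsBigO.of_bound (Real.exp 1 * (k + 1)) ?_
  filter_upwards [eventually_le_atBot (-1 : ℝ)] with s hs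
  have hs0 : 0 < -s := by linarith
  have h1 : limitFraction (k + 1) s - (-((k + 1 : ℕ) : ℝ) / s) =
      Real.exp s / (s * expMoment k s) := by
    rw [← limitFraction_succ_add k (by linarith : s < 0).ne]
    push_cast
    ring
  have h2 : Real.exp (-1) * (((-s)⁻¹) ^ (k + 1) / (k + 1)) ≤ expMoment k s := by
    refine exp_neg_mul_pow_le_expMoment k (inv_pos.2 hs0).le (inv_le_one_of_one_le₀ (by linarith))
      zero_le_one (le_of_eq ?_)
    rw [inv_neg, mul_neg, mul_inv_cancel₀ (by linarith : s < 0).ne]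
  have h3 : 0 < Real.exp (-1) * (((-s)⁻¹) ^ (k + 1) / (k + 1)) := by positivity
  rw [h1, norm_div, norm_mul, Real.norm_of_nonneg (Real.exp_pos s).le, Real.norm_eq_abs s,
    abs_of_neg (by linarith : s < 0), Real.norm_of_nonneg (expMoment_pos k s).le,
    Real.norm_of_nonneg (by positivity)]
  calc Real.exp s / (-s * expMoment k s)
      ≤ Real.exp s / (-s * (Real.exp (-1) * (((-s)⁻¹) ^ (k + 1) / (k + 1)))) := by gcongr
    _ = Real.exp 1 * (k + 1) * ((-s) ^ k * Real.exp s) := by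
      rw [Real.exp_neg, inv_pow, pow_succ]
      generalize -s = r at hs0
      field_simp

/-- The expansion of `s e^{-s} ∫_0^1 t^k e^{st} dt` as `s → +∞`. -/
lemma mul_exp_neg_mul_expMoment_isBigO (k : ℕ) :
    (fun s : ℝ => s * Real.exp (-s) * expMoment k s - (1 - k / s + k * (k - 1) / s ^ 2)) =O[atTop]
      (fun s : ℝ => 1 / s ^ 3) := by
  have hone : ∀ c : ℝ, (fun s : ℝ => c / s ^ 3) =O[atTop] (fun s : ℝ => 1 / s ^ 3) := by
    intro c
    refine ((isBigO_refl (fun s : ℝ => 1 / s ^ 3) atTop).const_mul_left c).congr_left fun s => ?_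
    ring
  induction k with
  | zero =>
    have h := (isLittleO_exp_neg_mul_rpow_atTop one_pos (-3 : ℝ)).isBigO.neg_left
    refine h.congr' ?_ ?_
    · filter_upwards with s
      have : s * Real.exp (-s) * expMoment 0 s = Real.exp (-s) * (s * expMoment 0 s) := by ring
      rw [this, mul_expMoment_zero, mul_sub, ← Real.exp_add]
      simp
    · filter_upwards [eventually_gt_atTop 0] with s hs
      rw [Real.rpow_neg hs.le, one_div]
      norm_cast
  | succ k ih =>
    have h1 : (fun s : ℝ => ((k : ℝ) + 1) / s *
        (s * Real.exp (-s) * expMoment k s - (1 - k / s + k * (k - 1) / s ^ 2))) =O[atTop]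
        (fun s : ℝ => 1 * (1 / s ^ 3)) := by
      refine IsBigO.mul ?_ ih
      refine (tendsto_const_nhds.div_atTop tendsto_id).isBigO_one ℝ
    simp only [one_mul] at h1
    have h2 := (h1.add (hone (((k : ℝ) + 1) * (k * (k - 1))))).neg_left
    refine h2.congr' ?_ EventuallyEq.rfl
    filter_upwards [eventually_gt_atTop 0] with s hs
    have hexp : Real.exp (-s) * Real.exp s = 1 := by rw [← Real.exp_add]; simp
    have hrec : s * Real.exp (-s) * expMoment (k + 1) s =
        1 - (k + 1) * (Real.exp (-s) * expMoment k s) := by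
      linear_combination Real.exp (-s) * mul_expMoment_succ k s + hexp
    rw [hrec]
    push_cast
    field_simp
    ring

lemma limitFraction_isBigO_atTop (k : ℕ) :
    (fun s : ℝ => limitFraction (k + 1) s - (1 - 1 / s + (((k + 1 : ℕ) : ℝ) - 1) / s ^ 2)) =O[atTop]
      (fun s : ℝ => 1 / s ^ 3) := by
  set J : ℝ → ℝ := fun s => s * Real.exp (-s) * expMoment k s with hJ
  set e : ℝ → ℝ := fun s => J s - (1 - k / s + k * (k - 1) / s ^ 2) with he
  have hE : e =O[atTop] (fun s : ℝ => 1 / s ^ 3) := mul_exp_neg_mul_expMoment_isBigO k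
  have hinv : ∀ (c : ℝ) (n : ℕ), n ≠ 0 → Tendsto (fun s : ℝ => c / s ^ n) atTop (𝓝 0) :=
    fun c n hn => tendsto_const_nhds.div_atTop (tendsto_pow_atTop hn)
  have hpoly : Tendsto (fun s : ℝ => 1 + k / s ^ 1 + k / s ^ 2) atTop (𝓝 (1 + 0 + 0)) :=
    (tendsto_const_nhds.add (hinv k 1 one_ne_zero)).add (hinv k 2 two_ne_zero)
  have hrest : Tendsto (fun s : ℝ => (k : ℝ) ^ 2 * (2 - k) + (-(k : ℝ) ^ 2 * (k - 1)) / s ^ 1) atTop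
      (𝓝 ((k : ℝ) ^ 2 * (2 - k) + 0)) := tendsto_const_nhds.add (hinv _ 1 one_ne_zero)
  have hJ1 : Tendsto J atTop (𝓝 1) := by
    have h0 : Tendsto e atTop (𝓝 0) := hE.trans_tendsto (hinv 1 3 three_ne_zero)
    have h1 : Tendsto (fun s : ℝ => 1 - k / s ^ 1 + k * (k - 1) / s ^ 2) atTop
        (𝓝 (1 - 0 + 0)) :=
      (tendsto_const_nhds.sub (hinv k 1 one_ne_zero)).add (hinv _ 2 two_ne_zero)
    have h2 := h0.add h1
    simp only [sub_zero, add_zero, zero_add] at h2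
    refine h2.congr fun s => ?_
    simp only [he, pow_one]
    ring
  have hJinv : (fun s => (J s)⁻¹) =O[atTop] (fun _ : ℝ => (1 : ℝ)) :=
    (hJ1.inv₀ one_ne_zero).isBigO_one ℝ
  have hnum : (fun s : ℝ => -(e s * (1 + k / s ^ 1 + k / s ^ 2)) +
      (1 / s ^ 3) * ((k : ℝ) ^ 2 * (2 - k) + (-(k : ℝ) ^ 2 * (k - 1)) / s ^ 1)) =O[atTop]
      (fun s : ℝ => 1 / s ^ 3 * 1) :=
    (hE.mul (hpoly.isBigO_one ℝ)).neg_left.add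
      ((isBigO_refl _ _).mul (hrest.isBigO_one ℝ))
  refine (hnum.mul hJinv).congr' ?_ (Eventually.of_forall fun s => by simp)
  filter_upwards [eventually_gt_atTop 0] with s hs
  have hJpos : 0 < J s := mul_pos (mul_pos hs (Real.exp_pos _)) (expMoment_pos k s)
  have hP : limitFraction (k + 1) s = (J s)⁻¹ - (k + 1) / s := by
    rw [eq_sub_iff_add_eq, limitFraction_succ_add k hs.ne']
    simp only [hJ]
    rw [Real.exp_neg]
    have := expMoment_pos k s
    have := Real.exp_pos s
    field_simp
  rw [hP]
  simp only [he]
  generalize J s = y at *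
  push_cast
  field_simp
  ring

/-- Left Riemann sums of a Lipschitz function over `N` equal intervals have error `O(1/N)`. -/
lemma abs_riemannSum_sub_integral_le {f : ℝ → ℝ} (hf : Continuous f) {M : ℝ} (hM : 0 ≤ M)
    (hlip : ∀ x ∈ Set.Icc (0 : ℝ) 1, ∀ y ∈ Set.Icc (0 : ℝ) 1, |f y - f x| ≤ M * |y - x|)
    {N : ℕ} (hN : 1 ≤ N) :
    |(N : ℝ)⁻¹ * ∑ m ∈ Finset.range N, f (m / N) - ∫ t in (0 : ℝ)..1, f t| ≤ M / N := by
  have hN0 : (0 : ℝ) < N := by exact_mod_cast hN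
  have hsum : ∑ m ∈ Finset.range N, ∫ t in ((m : ℝ) / N)..((m + 1 : ℕ) : ℝ) / N, f t =
      ∫ t in (0 : ℝ)..1, f t := by
    rw [intervalIntegral.sum_integral_adjacent_intervals (a := fun m : ℕ => (m : ℝ) / N)
      fun m _ => hf.intervalIntegrable _ _]
    simp [hN0.ne']
  have hterm : ∀ m ∈ Finset.range N,
      |(N : ℝ)⁻¹ * f (m / N) - ∫ t in ((m : ℝ) / N)..((m + 1 : ℕ) : ℝ) / N, f t| ≤
        M / N * (N : ℝ)⁻¹ := by
    intro m hm
    have hmN : ((m + 1 : ℕ) : ℝ) ≤ N := by exact_mod_cast Finset.mem_range.1 hm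
    have hlen : ((m + 1 : ℕ) : ℝ) / N - m / N = (N : ℝ)⁻¹ := by
      push_cast
      ring
    have hle : (m : ℝ) / N ≤ ((m + 1 : ℕ) : ℝ) / N := by
      rw [← sub_nonneg, hlen]
      positivity
    have h0 : (0 : ℝ) ≤ m / N := by positivity
    have h1 : ((m + 1 : ℕ) : ℝ) / N ≤ 1 := (div_le_one hN0).2 hmN
    have hconst : (N : ℝ)⁻¹ * f (m / N) =
        ∫ _ in ((m : ℝ) / N)..((m + 1 : ℕ) : ℝ) / N, f (m / N) := by
      rw [intervalIntegral.integral_const, hlen, smul_eq_mul]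
    rw [hconst, ← intervalIntegral.integral_sub intervalIntegrable_const
      (hf.intervalIntegrable _ _), ← Real.norm_eq_abs]
    refine (intervalIntegral.norm_integral_le_of_norm_le_const (C := M / N) fun t ht => ?_).trans
      (le_of_eq ?_)
    · rw [Set.uIoc_of_le hle] at ht
      rw [Real.norm_eq_abs, abs_sub_comm]
      refine (hlip _ ⟨h0, hle.trans h1⟩ t ⟨h0.trans ht.1.le, ht.2.trans h1⟩).trans ?_
      rw [abs_of_nonneg (sub_nonneg.2 ht.1.le), div_eq_mul_inv M]
      exact mul_le_mul_of_nonneg_left ((sub_le_sub_right ht.2 _).trans_eq hlen) hM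
    · rw [hlen, abs_of_pos (inv_pos.2 hN0)]
  rw [← hsum, Finset.mul_sum, ← Finset.sum_sub_distrib]
  refine (Finset.abs_sum_le_sum_abs _ _).trans ((Finset.sum_le_sum hterm).trans (le_of_eq ?_))
  rw [Finset.sum_const, Finset.card_range, nsmul_eq_mul]
  field_simp

lemma abs_riemannSum_sub_expMoment_le (n : ℕ) {A s : ℝ} (hs : |s| ≤ A) {N : ℕ} (hN : 1 ≤ N) :
    |(N : ℝ)⁻¹ * ∑ m ∈ Finset.range (N + 1), ((m : ℝ) / N) ^ n * Real.exp (s * (m / N)) -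
      expMoment n s| ≤ ((n + A + 1) * Real.exp A) / N := by
  have hN0 : (0 : ℝ) < N := by exact_mod_cast hN
  have hA : 0 ≤ A := (abs_nonneg s).trans hs
  have hexp : ∀ t ∈ Set.Icc (0 : ℝ) 1, Real.exp (s * t) ≤ Real.exp A := fun t ht =>
    Real.exp_le_exp.2 ((mul_le_mul_of_nonneg_right ((le_abs_self s).trans hs) ht.1).trans
      (mul_le_of_le_one_right hA ht.2))
  have hder : ∀ t : ℝ, HasDerivAt (fun t : ℝ => t ^ n * Real.exp (s * t))
      ((n * t ^ (n - 1) + t ^ n * s) * Real.exp (s * t)) t := by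
    intro t
    have h := ((hasDerivAt_id t).const_mul s).exp
    simp only [id, mul_one] at h
    exact ((hasDerivAt_pow n t).mul h).congr_deriv (by ring)
  have hlip : ∀ x ∈ Set.Icc (0 : ℝ) 1, ∀ y ∈ Set.Icc (0 : ℝ) 1,
      |y ^ n * Real.exp (s * y) - x ^ n * Real.exp (s * x)| ≤
        ((n + A) * Real.exp A) * |y - x| := by
    intro x hx y hy
    refine Convex.norm_image_sub_le_of_norm_hasDerivWithin_le
      (f := fun t : ℝ => t ^ n * Real.exp (s * t)) (fun t _ => (hder t).hasDerivWithinAt)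
      (fun t ht => ?_) (convex_Icc (0 : ℝ) 1) hx hy
    rw [norm_mul, Real.norm_of_nonneg (Real.exp_pos _).le]
    refine mul_le_mul ?_ (hexp t ht) (Real.exp_pos _).le (by positivity)
    refine (norm_add_le _ _).trans (add_le_add ?_ ?_)
    · rw [Real.norm_of_nonneg (mul_nonneg n.cast_nonneg (pow_nonneg ht.1 _))]
      exact mul_le_of_le_one_right n.cast_nonneg (pow_le_one₀ ht.1 ht.2)
    · rw [norm_mul, Real.norm_of_nonneg (pow_nonneg ht.1 _), Real.norm_eq_abs]
      exact (mul_le_of_le_one_left (abs_nonneg s) (pow_le_one₀ ht.1 ht.2)).trans hs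
  have h := abs_riemannSum_sub_integral_le (f := fun t : ℝ => t ^ n * Real.exp (s * t))
    (by fun_prop) (by positivity) hlip hN
  rw [Finset.sum_range_succ, div_self hN0.ne', one_pow, one_mul, mul_one, mul_add, add_sub_right_comm]
  refine (abs_add_le _ _).trans ((add_le_add h (le_of_eq (abs_of_pos (by positivity)))).trans ?_)
  have hlast := hexp 1 ⟨zero_le_one, le_rfl⟩
  rw [mul_one] at hlast
  rw [inv_mul_eq_div, ← add_div]
  gcongr
  linarith

lemma abs_ascFactorial_div_sub_pow_le (k : ℕ) {m N : ℕ} (hN : 1 ≤ N) (hm : m ≤ N) :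
    |((m + 1).ascFactorial k : ℝ) / N ^ k - ((m : ℝ) / N) ^ k| ≤
      ((k : ℝ) * k * (1 + k) ^ (k - 1)) / N := by
  have hN0 : (0 : ℝ) < N := by exact_mod_cast hN
  have hN1 : (1 : ℝ) ≤ N := by exact_mod_cast hN
  have hmN : (m : ℝ) / N ≤ 1 := (div_le_one hN0).2 (by exact_mod_cast hm)
  have h1 : ((m : ℝ) / N) ^ k ≤ ((m + 1).ascFactorial k : ℝ) / N ^ k := by
    rw [div_pow]
    gcongr
    exact_mod_cast (Nat.pow_le_pow_left m.le_succ k).trans (Nat.pow_succ_le_ascFactorial (m + 1) k)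
  have h2 : ((m + 1).ascFactorial k : ℝ) / N ^ k ≤ ((m + k : ℝ) / N) ^ k := by
    rw [div_pow]
    gcongr
    exact_mod_cast Nat.ascFactorial_le_pow_add m k
  have h3 := abs_pow_sub_pow_le ((m + k : ℝ) / N) ((m : ℝ) / N) k
  rw [abs_of_nonneg (sub_nonneg.2 h1)]
  refine (sub_le_sub_right h2 _).trans ((le_abs_self _).trans (h3.trans ?_))
  have h4 : (m + k : ℝ) / N - m / N = k / N := by ring
  have h5 : max |(m + k : ℝ) / N| |(m : ℝ) / N| ≤ 1 + k := by
    rw [abs_of_nonneg (by positivity), abs_of_nonneg (by positivity)]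
    refine max_le ?_ (hmN.trans (by linarith [k.cast_nonneg (α := ℝ)]))
    rw [add_div]
    exact add_le_add hmN (div_le_self k.cast_nonneg hN1)
  rw [h4, abs_of_nonneg (by positivity)]
  calc (k : ℝ) / N * k * max |(m + k : ℝ) / N| |(m : ℝ) / N| ^ (k - 1)
      ≤ (k : ℝ) / N * k * (1 + k) ^ (k - 1) := by gcongr
    _ = ((k : ℝ) * k * (1 + k) ^ (k - 1)) / N := by ring

lemma one_add_div_pow_le_exp {A s : ℝ} (hs : |s| ≤ A) {m N : ℕ} (hN : 1 ≤ N) (hAN : A ≤ N)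
    (hm : m ≤ N) : (1 + s / N) ^ m ≤ Real.exp A := by
  have hN0 : (0 : ℝ) < N := by exact_mod_cast hN
  have hA : 0 ≤ A := (abs_nonneg s).trans hs
  have h0 : 0 ≤ 1 + s / N := by
    have : -1 ≤ s / N := by
      rw [le_div_iff₀ hN0]
      linarith [neg_abs_le s]
    linarith
  have h1 : 1 + s / N ≤ Real.exp (A / N) :=
    (add_comm 1 (s / N) ▸ Real.add_one_le_exp (s / N)).trans
      (Real.exp_le_exp.2 (by gcongr; exact (le_abs_self s).trans hs))
  calc (1 + s / N) ^ m ≤ Real.exp (A / N) ^ m := by gcongr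
    _ = Real.exp (m * (A / N)) := (Real.exp_nat_mul _ _).symm
    _ ≤ Real.exp A := by
      refine Real.exp_le_exp.2 ?_
      rw [← mul_div_assoc, div_le_iff₀ hN0, mul_comm]
      gcongr

lemma abs_one_add_div_pow_sub_exp_le {A s : ℝ} (hs : |s| ≤ A) {m N : ℕ} (hN : 1 ≤ N)
    (hAN : A ≤ N) (hm : m ≤ N) :
    |(1 + s / N) ^ m - Real.exp (s * (m / N))| ≤ (A ^ 2 * Real.exp A) / N := by
  have hN0 : (0 : ℝ) < N := by exact_mod_cast hN
  have hA : 0 ≤ A := (abs_nonneg s).trans hs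
  have hsN : |s / N| ≤ A / N := by
    rw [abs_div, abs_of_pos hN0]
    gcongr
  have hAN1 : A / N ≤ 1 := (div_le_one hN0).2 hAN
  have h0 : 0 ≤ 1 + s / N := by linarith [neg_abs_le (s / N)]
  have hv : Real.exp (s * (m / N)) = Real.exp (s / N) ^ m := by
    rw [← Real.exp_nat_mul]
    congr 1
    ring
  have hd : |1 + s / N - Real.exp (s / N)| ≤ (A / N) ^ 2 := by
    rw [abs_sub_comm, ← sub_sub]
    refine (Real.abs_exp_sub_one_sub_id_le (hsN.trans hAN1)).trans ?_
    rw [← sq_abs]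
    gcongr
  have hmax : max |1 + s / N| |Real.exp (s / N)| ≤ Real.exp (A / N) := by
    have h1 : Real.exp (s / N) ≤ Real.exp (A / N) :=
      Real.exp_le_exp.2 ((le_abs_self _).trans hsN)
    rw [abs_of_nonneg h0, abs_of_pos (Real.exp_pos _)]
    exact max_le ((add_comm 1 (s / N) ▸ Real.add_one_le_exp (s / N)).trans h1) h1
  have hpow : Real.exp (A / N) ^ (m - 1) ≤ Real.exp A := by
    rw [← Real.exp_nat_mul]
    refine Real.exp_le_exp.2 ?_
    rw [← mul_div_assoc, div_le_iff₀ hN0, mul_comm]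
    gcongr
    exact (Nat.sub_le m 1).trans hm
  rw [hv]
  refine (abs_pow_sub_pow_le _ _ _).trans ?_
  calc |1 + s / N - Real.exp (s / N)| * m * max |1 + s / N| |Real.exp (s / N)| ^ (m - 1)
      ≤ (A / N) ^ 2 * N * Real.exp (A / N) ^ (m - 1) := by gcongr
    _ ≤ (A / N) ^ 2 * N * Real.exp A := by gcongr
    _ = (A ^ 2 * Real.exp A) / N := by field_simp

/-- The normalised kernel sums `N^{-1} ∑_{m=0}^N (m/N)^j (m+1)⋯(m+k) N^{-k} x^m`. -/
noncomputable def scaledSum (k j N : ℕ) (x : ℝ) : ℝ :=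
  (N : ℝ)⁻¹ * ∑ m ∈ Finset.range (N + 1),
    ((m : ℝ) / N) ^ j * ((((m + 1).ascFactorial k : ℕ) : ℝ) / N ^ k * x ^ m)

lemma exists_abs_scaledSum_sub_expMoment_le (k j : ℕ) (A : ℝ) :
    ∃ C : ℝ, ∀ N : ℕ, 1 ≤ N → A ≤ N → ∀ s : ℝ, |s| ≤ A →
      |scaledSum k j N (1 + s / N) - expMoment (k + j) s| ≤ C / N := by
  set B : ℝ := ((k : ℝ) * k * (1 + k) ^ (k - 1)) with hB
  refine ⟨2 * (B * Real.exp A + A ^ 2 * Real.exp A) +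
    (((k + j : ℕ) : ℝ) + A + 1) * Real.exp A, fun N hN hAN s hs => ?_⟩
  have hN0 : (0 : ℝ) < N := by exact_mod_cast hN
  have hN1 : (1 : ℝ) ≤ N := by exact_mod_cast hN
  have hterm : ∀ m ∈ Finset.range (N + 1),
      |((m : ℝ) / N) ^ j * ((((m + 1).ascFactorial k : ℕ) : ℝ) / N ^ k * (1 + s / N) ^ m) -
        ((m : ℝ) / N) ^ (k + j) * Real.exp (s * (m / N))| ≤
      (B * Real.exp A + A ^ 2 * Real.exp A) / N := by
    intro m hm
    have hmN : m ≤ N := Nat.lt_succ_iff.1 (Finset.mem_range.1 hm)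
    have hx0 : (0 : ℝ) ≤ m / N := by positivity
    have hx1 : (m : ℝ) / N ≤ 1 := (div_le_one hN0).2 (by exact_mod_cast hmN)
    have hu0 : 0 ≤ 1 + s / N := by
      have : -1 ≤ s / N := by
        rw [le_div_iff₀ hN0]
        linarith [neg_abs_le s]
      linarith
    have e : ((m : ℝ) / N) ^ j * ((((m + 1).ascFactorial k : ℕ) : ℝ) / N ^ k * (1 + s / N) ^ m) -
        ((m : ℝ) / N) ^ (k + j) * Real.exp (s * (m / N)) =
        ((m : ℝ) / N) ^ j *
        (((((m + 1).ascFactorial k : ℕ) : ℝ) / N ^ k - ((m : ℝ) / N) ^ k) * (1 + s / N) ^ m +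
          ((m : ℝ) / N) ^ k * ((1 + s / N) ^ m - Real.exp (s * (m / N)))) := by ring
    have h1 := abs_ascFactorial_div_sub_pow_le k hN hmN
    have h2 := one_add_div_pow_le_exp hs hN hAN hmN
    have h3 := abs_one_add_div_pow_sub_exp_le hs hN hAN hmN
    rw [e, abs_mul, abs_of_nonneg (pow_nonneg hx0 j)]
    refine (mul_le_of_le_one_left (abs_nonneg _) (pow_le_one₀ hx0 hx1)).trans ?_
    refine (abs_add_le _ _).trans ?_
    rw [abs_mul, abs_mul, abs_of_nonneg (pow_nonneg hu0 m), abs_of_nonneg (pow_nonneg hx0 k), add_div]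
    refine add_le_add ?_ ((mul_le_of_le_one_left (abs_nonneg _) (pow_le_one₀ hx0 hx1)).trans h3)
    refine (mul_le_mul h1 h2 (pow_nonneg hu0 m) (by positivity)).trans (le_of_eq ?_)
    ring
  have hR := abs_riemannSum_sub_expMoment_le (k + j) hs hN
  have hS : |scaledSum k j N (1 + s / N) - (N : ℝ)⁻¹ * ∑ m ∈ Finset.range (N + 1),
      ((m : ℝ) / N) ^ (k + j) * Real.exp (s * (m / N))| ≤
      2 * (B * Real.exp A + A ^ 2 * Real.exp A) / N := by
    rw [scaledSum, ← mul_sub, ← Finset.sum_sub_distrib, abs_mul, abs_of_pos (inv_pos.2 hN0),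
      inv_mul_le_iff₀ hN0]
    refine (Finset.abs_sum_le_sum_abs _ _).trans ((Finset.sum_le_sum hterm).trans ?_)
    rw [Finset.sum_const, Finset.card_range, nsmul_eq_mul, mul_div_assoc', mul_div_cancel₀ _ hN0.ne',
      div_le_iff₀ hN0]
    push_cast
    have : 0 ≤ B * Real.exp A + A ^ 2 * Real.exp A := by positivity
    nlinarith
  have := abs_sub_le (scaledSum k j N (1 + s / N)) ((N : ℝ)⁻¹ * ∑ m ∈ Finset.range (N + 1),
      ((m : ℝ) / N) ^ (k + j) * Real.exp (s * (m / N))) (expMoment (k + j) s)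
  rw [add_div]
  linarith

lemma choose_mul_factorial (k m : ℕ) :
    ((m + (k + 1) - 1).choose m) * k.factorial = (m + 1).ascFactorial k := by
  rw [Nat.ascFactorial_eq_factorial_mul_choose, ← add_assoc, Nat.add_sub_cancel,
    Nat.choose_symm_add, mul_comm]

lemma scaledSum_zero (k : ℕ) {N : ℕ} (x : ℝ) :
    scaledSum k 0 N x = k.factorial / N ^ (k + 1) * kernelSum (k + 1) N x := by
  rw [scaledSum, kernelSum, Finset.mul_sum, Finset.mul_sum]
  refine Finset.sum_congr rfl fun m _ => ?_
  rw [← choose_mul_factorial]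
  push_cast
  ring

lemma scaledSum_one (k : ℕ) {N : ℕ} (x : ℝ) :
    scaledSum k 1 N x = k.factorial / N ^ (k + 1) * ((N : ℝ)⁻¹ * kernelMoment (k + 1) N x) := by
  rw [scaledSum, kernelMoment, Finset.mul_sum, Finset.mul_sum, Finset.mul_sum]
  refine Finset.sum_congr rfl fun m _ => ?_
  rw [← choose_mul_factorial]
  push_cast
  ring

lemma inv_mul_kernelMoment_div_kernelSum (k : ℕ) {N : ℕ} (hN : 1 ≤ N) (x : ℝ) :
    (N : ℝ)⁻¹ * (kernelMoment (k + 1) N x / kernelSum (k + 1) N x) =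
      scaledSum k 1 N x / scaledSum k 0 N x := by
  have hN0 : (0 : ℝ) < N := by exact_mod_cast hN
  rw [scaledSum_zero, scaledSum_one, mul_div_mul_left _ _ (by positivity), mul_div_assoc]

lemma kernelMoment_le (L N : ℕ) {x : ℝ} (hx : 0 ≤ x) :
    kernelMoment L N x ≤ N * kernelSum L N x := by
  rw [kernelMoment, kernelSum, Finset.mul_sum]
  refine Finset.sum_le_sum fun m hm => ?_
  have : (m : ℝ) ≤ N := by exact_mod_cast Nat.lt_succ_iff.1 (Finset.mem_range.1 hm)
  gcongr

lemma kernelMoment_nonneg (L N : ℕ) {x : ℝ} (hx : 0 ≤ x) : 0 ≤ kernelMoment L N x :=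
  Finset.sum_nonneg fun m _ => by positivity

lemma inv_mul_kernelMoment_div_kernelSum_mem_Icc (L : ℕ) {N : ℕ} (hN : 1 ≤ N) {x : ℝ}
    (hx : 0 ≤ x) :
    (N : ℝ)⁻¹ * (kernelMoment L N x / kernelSum L N x) ∈ Set.Icc (0 : ℝ) 1 := by
  have hN0 : (0 : ℝ) < N := by exact_mod_cast hN
  have hK := kernelSum_pos L N hx
  refine ⟨mul_nonneg (by positivity) (div_nonneg (kernelMoment_nonneg L N hx) hK.le), ?_⟩
  rw [inv_mul_le_iff₀ hN0, mul_one, div_le_iff₀ hK]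
  exact kernelMoment_le L N hx

lemma abs_div_sub_div_le {a b c d : ℝ} (hb : b ≠ 0) (hd : 0 < d) (hab : |a / b| ≤ 1) :
    |a / b - c / d| ≤ (|a - c| + |b - d|) / d := by
  have e : a / b - c / d = ((a - c) + a / b * (d - b)) / d := by
    field_simp
    ring
  rw [e, abs_div, abs_of_pos hd]
  gcongr
  refine (abs_add_le _ _).trans (add_le_add_right ?_ _)
  rw [abs_mul, abs_sub_comm d b]
  exact mul_le_of_le_one_left (abs_nonneg _) hab

lemma exists_abs_kernel_ratio_sub_limitFraction_le (k : ℕ) {A : ℝ} (hA : 0 < A) :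
    ∃ C : ℝ, ∀ N : ℕ, 1 ≤ N → 2 * A ≤ N → ∀ s : ℝ, |s| ≤ A →
      |(N : ℝ)⁻¹ * (kernelMoment (k + 1) N (1 + s / N) / kernelSum (k + 1) N (1 + s / N)) -
        limitFraction (k + 1) s| ≤ C / N := by
  obtain ⟨C₀, h₀⟩ := exists_abs_scaledSum_sub_expMoment_le k 0 A
  obtain ⟨C₁, h₁⟩ := exists_abs_scaledSum_sub_expMoment_le k 1 A
  refine ⟨(C₁ + C₀) / (Real.exp (-A) / (k + 1)), fun N hN hAN s hs => ?_⟩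
  have hN0 : (0 : ℝ) < N := by exact_mod_cast hN
  have hx : 0 ≤ 1 + s / N := by
    have : -1 ≤ s / N := by
      rw [le_div_iff₀ hN0]
      linarith [neg_abs_le s]
    linarith
  have hmem := inv_mul_kernelMoment_div_kernelSum_mem_Icc (k + 1) hN hx
  rw [inv_mul_kernelMoment_div_kernelSum k hN] at hmem ⊢
  have hD : scaledSum k 0 N (1 + s / N) ≠ 0 := by
    rw [scaledSum_zero]
    have := kernelSum_pos (k + 1) N hx
    positivity
  rw [limitFraction_succ]
  have hpos := expMoment_pos k s
  have hlow := exp_neg_div_le_expMoment k hA.le (by linarith [neg_abs_le s] : -A ≤ s)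
  have e₀ := h₀ N hN (by linarith) s hs
  have e₁ := h₁ N hN (by linarith) s hs
  rw [add_zero] at e₀
  calc |scaledSum k 1 N (1 + s / N) / scaledSum k 0 N (1 + s / N) -
        expMoment (k + 1) s / expMoment k s|
      ≤ (|scaledSum k 1 N (1 + s / N) - expMoment (k + 1) s| +
          |scaledSum k 0 N (1 + s / N) - expMoment k s|) / expMoment k s :=
        abs_div_sub_div_le hD hpos (by rw [abs_of_nonneg hmem.1]; exact hmem.2)
    _ ≤ (C₁ / N + C₀ / N) / expMoment k s := by gcongr
    _ ≤ (C₁ / N + C₀ / N) / (Real.exp (-A) / (k + 1)) := by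
        have : 0 ≤ C₁ / N + C₀ / N :=
          add_nonneg ((abs_nonneg _).trans e₁) ((abs_nonneg _).trans e₀)
        gcongr
    _ = (C₁ + C₀) / (Real.exp (-A) / (k + 1)) / N := by ring

lemma IsStdComplexGaussianFamily.expectedFraction_eq {Ω : Type*} [MeasurableSpace Ω]
    {μ : Measure Ω} [IsProbabilityMeasure μ] {L N : ℕ} {a : Fin (N + 1) → Ω → ℂ}
    (ha : IsStdComplexGaussianFamily μ a) {x : ℝ} (hx : 0 < x) :
    expectedFraction μ L a x = (N : ℝ)⁻¹ * (kernelMoment L N x / kernelSum L N x) := by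
  rw [expectedFraction, ha.integral_zeroCount hx]

lemma expectedFraction_mem_Icc {Ω : Type*} [MeasurableSpace Ω]
    (μ : Measure Ω) [IsProbabilityMeasure μ] (L : ℕ) {N : ℕ} (hN : 1 ≤ N)
    (a : Fin (N + 1) → Ω → ℂ) (x : ℝ) :
    expectedFraction μ L a x ∈ Set.Icc (0 : ℝ) 1 := by
  have hN0 : (0 : ℝ) < N := by exact_mod_cast hN
  have h0 : 0 ≤ ∫ ω, (zeroCount (poly L N (fun m => a m ω)) x : ℝ) ∂μ :=
    integral_nonneg fun ω => Nat.cast_nonneg _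
  refine ⟨mul_nonneg (by positivity) h0, ?_⟩
  rw [expectedFraction, inv_mul_le_iff₀ hN0, mul_one]
  refine (Real.le_norm_self _).trans
    ((norm_integral_le_of_norm_le_const (C := (N : ℝ)) (Eventually.of_forall fun ω => ?_)).trans
      (le_of_eq ?_))
  · rw [Real.norm_natCast]
    exact_mod_cast zeroCount_poly_le L N _ x
  · simp

/-- Uniform convergence, with rate `1/N`, of the expected fraction of zeros. -/
theorem exists_abs_expectedFraction_sub_limitFraction_le (k : ℕ) {A : ℝ} (hA : 0 < A) :
    ∃ C : ℝ, ∀ (Ω : Type u) [MeasurableSpace Ω] (μ : Measure Ω)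
      [IsProbabilityMeasure μ] (N : ℕ) (a : Fin (N + 1) → Ω → ℂ), 1 ≤ N →
      IsStdComplexGaussianFamily μ a → ∀ s ∈ Set.Icc (-A) A,
        |expectedFraction μ (k + 1) a (1 + s / N) - limitFraction (k + 1) s| ≤ C / N := by
  obtain ⟨C, hC⟩ := exists_abs_kernel_ratio_sub_limitFraction_le k hA
  refine ⟨max C (2 * A), fun Ω _ μ _ N a hN ha s hs => ?_⟩
  have hN0 : (0 : ℝ) < N := by exact_mod_cast hN
  rcases le_or_gt (2 * A) N with h | h
  · have hx : 0 < 1 + s / N := by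
      have : -1 < s / N := by
        rw [lt_div_iff₀ hN0]
        linarith [hs.1]
      linarith
    rw [ha.expectedFraction_eq hx]
    refine (hC N hN h s (abs_le.2 hs)).trans ?_
    gcongr
    exact le_max_left _ _
  · have h1 := expectedFraction_mem_Icc μ (k + 1) hN a (1 + s / N)
    have h2 := limitFraction_succ_mem_Icc k s
    have h3 : |expectedFraction μ (k + 1) a (1 + s / N) - limitFraction (k + 1) s| ≤ 1 :=
      abs_le.2 ⟨by linarith [h1.1, h2.2], by linarith [h1.2, h2.1]⟩
    refine h3.trans ((one_le_div hN0).2 (h.le.trans (le_max_right _ _)))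

end SU11

theorem mainTheorem2 (L : ℕ) (hL : 1 ≤ L) :
    -- the number of zeros in a disk has a well-defined expectation
    (∀ (Ω : Type u) [MeasurableSpace Ω] (μ : Measure Ω) [IsProbabilityMeasure μ] (N : ℕ)
      (a : Fin (N + 1) → Ω → ℂ), SU11.IsStdComplexGaussianFamily μ a → ∀ x : ℝ,
        Integrable (fun ω => (SU11.zeroCount (SU11.poly L N (fun m => a m ω)) x : ℝ)) μ) ∧
    -- the limiting profile is well defined
    (ContDiff ℝ (⊤ : ℕ∞) SU11.g ∧ ∀ s : ℝ, 0 < iteratedDeriv (L - 1) SU11.g s) ∧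
    -- convergence of the expected fraction of zeros in the disk `|z|^2 ≤ 1 + s/N`
    (∀ (Ω : ℕ → Type u) [∀ N, MeasurableSpace (Ω N)] (μ : ∀ N, Measure (Ω N))
      [∀ N, IsProbabilityMeasure (μ N)] (a : ∀ N, Fin (N + 1) → Ω N → ℂ),
      (∀ N, SU11.IsStdComplexGaussianFamily (μ N) (a N)) → ∀ s : ℝ,
        Tendsto (fun N : ℕ => SU11.expectedFraction (μ N) L (a N) (1 + s / N)) atTop
          (𝓝 (SU11.limitFraction L s))) ∧
    -- with rate `O(1/N)`, uniformly for `s` in compact intervals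
    (∀ A : ℝ, 0 < A → ∃ C : ℝ, ∀ (Ω : Type u) [MeasurableSpace Ω] (μ : Measure Ω)
      [IsProbabilityMeasure μ] (N : ℕ) (a : Fin (N + 1) → Ω → ℂ), 1 ≤ N →
      SU11.IsStdComplexGaussianFamily μ a → ∀ s ∈ Set.Icc (-A) A,
        |SU11.expectedFraction μ L a (1 + s / N) - SU11.limitFraction L s| ≤ C / N) ∧
    -- the expected fraction of zeros in the unit disk
    (∃ C : ℝ, ∀ (Ω : Type u) [MeasurableSpace Ω] (μ : Measure Ω)
      [IsProbabilityMeasure μ] (N : ℕ) (a : Fin (N + 1) → Ω → ℂ), 1 ≤ N →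
      SU11.IsStdComplexGaussianFamily μ a →
        |SU11.expectedFraction μ L a 1 - (L : ℝ) / (L + 1)| ≤ C / N) ∧
    -- asymptotics of the limit at `-∞` and `+∞`
    ((fun s : ℝ => SU11.limitFraction L s - (-(L : ℝ) / s)) =O[atBot]
      (fun s : ℝ => (-s) ^ (L - 1) * Real.exp s)) ∧
    ((fun s : ℝ => SU11.limitFraction L s - (1 - 1 / s + ((L : ℝ) - 1) / s ^ 2)) =O[atTop]
      (fun s : ℝ => 1 / s ^ 3)) := by
  obtain ⟨k, rfl⟩ : ∃ k, L = k + 1 := ⟨L - 1, (Nat.sub_add_cancel hL).symm⟩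
  refine ⟨fun Ω _ μ _ N a ha x => ha.integrable_zeroCount x, ⟨SU11.contDiff_g, fun s => ?_⟩, ?_, ?_,
    ?_, SU11.limitFraction_isBigO_atBot k, SU11.limitFraction_isBigO_atTop k⟩
  · rw [SU11.iteratedDeriv_g]
    exact SU11.expMoment_pos _ s
  · intro Ω _ μ _ a ha s
    have hA : 0 < |s| + 1 := by positivity
    have hs : s ∈ Set.Icc (-(|s| + 1)) (|s| + 1) := abs_le.1 (by linarith)
    obtain ⟨C, hC⟩ := SU11.exists_abs_expectedFraction_sub_limitFraction_le.{u} k hA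
    rw [tendsto_iff_norm_sub_tendsto_zero]
    refine squeeze_zero' (Eventually.of_forall fun N => norm_nonneg _) ?_
      (tendsto_const_div_atTop_nhds_zero_nat C)
    filter_upwards [eventually_ge_atTop 1] with N hN
    exact hC (Ω N) (μ N) N (a N) hN (ha N) s hs
  · exact fun A hA => SU11.exists_abs_expectedFraction_sub_limitFraction_le k hA
  · obtain ⟨C, hC⟩ := SU11.exists_abs_expectedFraction_sub_limitFraction_le.{u} k one_pos
    refine ⟨C, fun Ω _ μ _ N a hN ha => ?_⟩
    have h := hC Ω μ N a hN ha 0 (by norm_num)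
    rwa [zero_div, add_zero, SU11.limitFraction_succ_zero] at h
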